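/- Let $p$ be a prime, let $|\cdot|_p$ be the $p$-adic absolute value, extended to an algebraic closure $\overline{\mathbb{Q}}_p$, and let $\log x=\sum_{n\ge 1}(-1)^{n-1}(x-1)^n/n$ for $|x-1|_p<1$. **Definitions.** For points $\mathbf v=(v_1:v_2)$, $\mathbf w=(w_1:w_2)$ of $\mathbf{P}^1_{\overline{\mathbb{Q}}_p}$ put $$d(\mathbf v,\mathbf w)=\frac{|v_1w_2-v_2w_1|_p}{\max\{|v_1|_p,|v_2|_p\}\cdot\max\{|w_1|_p,|w_2|_p\}},$$ and regard $\mathbf{P}^1_{\mathbb{Q}_p}$ as a subset of $\mathbf{P}^1_{\overline{\mathbb{Q}}_p}$. For $N\ge 1$ let $\mathbb{A}_N=\{1,\dots,N\}$. For $w=a_1a_2\dots\in\mathbb{A}_N^{\mathbb{N}}$ and $\mathbf q\in \mathbf{P}^1_{\mathbb{Q}_p}$ let $\mathrm{T}(w,\mathbf q)=(a_2a_3\dots,\,A_{a_1}\mathbf q)$, where $A_a=\begin{pmatrix}0&1\\1&a\end{pmatrix}$. For $\mathbf x=(w,\mathbf x_p)$ let $\mathbf x_{p,n}$ be the second component of $\mathrm{T}^n\mathbf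 x$ ($n\ge 0$), and let $$B_k(\mathbf x)=\{\mathbf q\in\mathbf{P}^1_{\mathbb{Q}_p}:\ \exists\, n\ge 0,\ d(\mathbf q,\mathbf x_{p,n})\le p^{-k}\}.$$ For $\epsilon>0$ let $\mathbf{PBad}_\epsilon$ be the set of $(q_1:q_2)\in\mathbf{P}^1_{\mathbb{Q}_p}$ with $$\frac{|aq_1+bq_2|_p}{\max\{|q_1|_p,|q_2|_p\}}\ge\frac{\epsilon}{\max\{a^2,b^2\}}\quad\text{for all }(a,b)\in\mathbb{Z}^2\setminus\{(0,0)\},$$ and let $\mathbf{LMad}_\epsilon$ be the set of pairs $\mathbf x$ with $\mathrm{T}^n\mathbf x\in\mathbb{A}_{M}^{\mathbb{N}}\times\mathbf{PBad}_\epsilon$ for all $n\ge 0$, where $M=[\epsilon^{-1}]+1$. For a matrix $A\in\mathrm{SL}_2^{\pm}(\mathbb{Z}_p)$ (that is, with entries in $\mathbb{Z}_p$ and $\det A=\pm1$) having two different eigenvectors in $\mathbf{P}^1_{\overline{\mathbb{Q}}_p}$, let $\kappa(A)$ be a positive integer with $\kappa(A)\le p^2$ and $|\lambda^{\kappa(A)}-1|_p\le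 p^{-1}$ for each eigenvalue $\lambda$ of $A$ (such an integer always exists; any choice is allowed). Let $\widetilde{\mathrm{SL}}_2(\mathbb{Z}_p)$ be the set of those $A$ for which $\log\lambda^{\kappa(A)}\ne0$ for each eigenvalue $\lambda$ of $A$. **Theorem.** Let $A\in\widetilde{\mathrm{SL}}_2(\mathbb{Z}_p)$, let $\mathbf w_1\neq\mathbf w_2$ be the two eigenvectors of $A^T$ in $\mathbf{P}^1_{\overline{\mathbb{Q}}_p}$, and let $\lambda_1$ be one of the eigenvalues of $A$. Let $\mathbf x=(w,\mathbf x_p)\in\mathbb{A}_N^{\mathbb{N}}\times\mathbf{P}^1_{\mathbb{Q}_p}$ for some $N\geq 1$, and define $$\epsilon_1=d(\mathbf x_p,\mathbf w_1),\quad \epsilon_2=d(\mathbf x_p,\mathbf w_2),\quad \epsilon_3=\left|\log\left(\lambda_1^{4\kappa(A)}\right)\right|_p,\quad \delta=\min\{\epsilon_1,\epsilon_2,p^{-1}\}.$$ Assume that $\delta\ne0$. Let $m\ge1$ and $k\ge0$ be integers with $$p^k\ge\frac{\sqrt{d(\mathbf w_1,\mathbf w_2)\cdot m}}{\epsilon_3\cdot\delta\cdot\sqrt{2\epsilon_1\epsilon_2\cdot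 p\cdot\kappa(A)}}.$$ If $$\{\mathbf x_p,\ A^T\mathbf x_p,\ \dots,\ (A^T)^m\mathbf x_p\}\subset B_k(\mathbf x),$$ then $\mathbf x\notin\mathbf{LMad}_\epsilon$ for $$\epsilon=\sqrt{\frac{2\epsilon_1\epsilon_2\cdot p\cdot\kappa(A)}{\epsilon_3^2\,\delta^2\cdot d(\mathbf w_1,\mathbf w_2)\cdot m}}.$$ -/

import Mathlib

open scoped LinearAlgebra.Projectivization

noncomputable section

/-- The projective line over a field `K`, in homogeneous coordinates `(x 0, x 1)`. -/
abbrev ProjLine (K : Type*) [Field K] : Type _ := ℙ K (Fin 2 → K)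

section Metric

variable {K : Type*} [NormedField K]

/-- `max (|x 0|, |x 1|)`; note `min (|x 0|⁻¹, |x 1|⁻¹) = 1 / vecHeight x` with `0⁻¹ = ∞`. -/
def vecHeight (x : Fin 2 → K) : ℝ := max ‖x 0‖ ‖x 1‖

/-- The distance `|v₀ w₁ - v₁ w₀| / (max(|v₀|,|v₁|) max(|w₀|,|w₁|))` on the projective line. -/
def projDist (v w : ProjLine K) : ℝ :=
  ‖v.rep 0 * w.rep 1 - v.rep 1 * w.rep 0‖ / (vecHeight v.rep * vecHeight w.rep)

theorem vecHeight_smul (c : K) (x : Fin 2 → K) : vecHeight (c • x) = ‖c‖ * vecHeight x := by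
  simp [vecHeight, mul_max_of_nonneg]

/-- `projDist` can be computed from any choice of homogeneous coordinates. -/
theorem projDist_mk (v w : Fin 2 → K) (hv : v ≠ 0) (hw : w ≠ 0) :
    projDist (.mk K v hv) (.mk K w hw) =
      ‖v 0 * w 1 - v 1 * w 0‖ / (vecHeight v * vecHeight w) := by
  obtain ⟨a, ha⟩ := Projectivization.exists_smul_eq_mk_rep K v hv
  obtain ⟨b, hb⟩ := Projectivization.exists_smul_eq_mk_rep K w hw
  have ha0 : ‖(a : K)‖ ≠ 0 := by simp
  have hb0 : ‖(b : K)‖ ≠ 0 := by simp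
  have e : (a : K) * v 0 * ((b : K) * w 1) - (a : K) * v 1 * ((b : K) * w 0)
      = (a : K) * b * (v 0 * w 1 - v 1 * w 0) := by ring
  rw [projDist, ← ha, ← hb, Units.smul_def, Units.smul_def, vecHeight_smul, vecHeight_smul]
  simp only [Pi.smul_apply, smul_eq_mul]
  rw [e, norm_mul, norm_mul,
    show ‖(a : K)‖ * vecHeight v * (‖(b : K)‖ * vecHeight w)
      = ‖(a : K)‖ * ‖(b : K)‖ * (vecHeight v * vecHeight w) by ring]
  exact mul_div_mul_left _ _ (mul_ne_zero ha0 hb0)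

end Metric

section Matrices

variable {R : Type*} [CommRing R]

/-- The transpose of an invertible `2 × 2` matrix. -/
def glTranspose (A : Matrix.GeneralLinearGroup (Fin 2) R) : Matrix.GeneralLinearGroup (Fin 2) R where
  val := (A : Matrix (Fin 2) (Fin 2) R).transpose
  inv := ((A⁻¹ : Matrix.GeneralLinearGroup (Fin 2) R) : Matrix (Fin 2) (Fin 2) R).transpose
  val_inv := by rw [← Matrix.transpose_mul, ← Units.val_mul, inv_mul_cancel]; simp
  inv_val := by rw [← Matrix.transpose_mul, ← Units.val_mul, mul_inv_cancel]; simp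

/-- The matrix `(0 1; 1 a)`, attached to the partial quotient `a`. -/
def cfMatrix (R : Type*) [CommRing R] (a : ℕ) : Matrix.GeneralLinearGroup (Fin 2) R where
  val := !![0, 1; 1, (a : R)]
  inv := !![-(a : R), 1; 1, 0]
  val_inv := by simp [Matrix.one_fin_two]
  inv_val := by simp [Matrix.one_fin_two]

end Matrices

section Shift

variable (p : ℕ) [Fact p.Prime]

/-- The extended shift `(a₁a₂…, q) ↦ (a₂a₃…, A_{a₁} q)`; the first letter of `w` is `w 0`. -/
def extShift (x : (ℕ → ℕ) × ProjLine ℚ_[p]) : (ℕ → ℕ) × ProjLine ℚ_[p] :=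
  (fun i => x.1 (i + 1), cfMatrix ℚ_[p] (x.1 0) • x.2)

/-- The infinite words over the alphabet `{1, …, N}`. -/
def boundedWords (N : ℕ) : Set (ℕ → ℕ) := {w | ∀ i, 1 ≤ w i ∧ w i ≤ N}

/-- The `p`-adically badly approximable points with constant `ε`: for all integers
`(a, b) ≠ (0, 0)`, `|a q₁ + b q₂|_p / max (|q₁|_p, |q₂|_p) ≥ ε / max (a², b²)`. -/
def PBad (ε : ℝ) : Set (ProjLine ℚ_[p]) :=
  {q | ∀ a b : ℤ, (a, b) ≠ (0, 0) →
    ε / max ((a : ℝ) ^ 2) ((b : ℝ) ^ 2) ≤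
      ‖(a : ℚ_[p]) * q.rep 0 + (b : ℚ_[p]) * q.rep 1‖ / vecHeight q.rep}

/-- The set `LMad_ε`: the whole forward orbit stays in `𝔸_N^ℕ × PBad_ε`, `N = ⌊ε⁻¹⌋ + 1`. -/
def LMad (ε : ℝ) : Set ((ℕ → ℕ) × ProjLine ℚ_[p]) :=
  {x | ∀ n : ℕ, ((extShift p)^[n] x).1 ∈ boundedWords (⌊ε⁻¹⌋₊ + 1) ∧
    ((extShift p)^[n] x).2 ∈ PBad p ε}

/-- `B_k(x)`: the `p^{-k}`-neighbourhood of the points `x_{p,n}`, the second components of the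
orbit of `x`. -/
def orbitNhd (k : ℕ) (x : (ℕ → ℕ) × ProjLine ℚ_[p]) : Set (ProjLine ℚ_[p]) :=
  {q | ∃ n : ℕ, projDist q ((extShift p)^[n] x).2 ≤ ((p : ℝ) ^ k)⁻¹}

end Shift

section AlgebraicClosure

variable (p : ℕ) [Fact p.Prime]

/-- Coordinatewise inclusion `ℚ_p² → (ℚ̄_p)²`. -/
def vecToAlgCl : (Fin 2 → ℚ_[p]) →ₛₗ[algebraMap ℚ_[p] (PadicAlgCl p)] (Fin 2 → PadicAlgCl p) where
  toFun v i := algebraMap ℚ_[p] (PadicAlgCl p) (v i)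
  map_add' v w := by ext i; simp
  map_smul' c v := by ext i; simp

theorem vecToAlgCl_injective : Function.Injective (vecToAlgCl p) := fun v w h => by
  ext i
  exact (algebraMap ℚ_[p] (PadicAlgCl p)).injective (congrFun h i)

/-- The inclusion of the projective line over `ℚ_p` in the one over `ℚ̄_p`. -/
def projToAlgCl : ProjLine ℚ_[p] → ProjLine (PadicAlgCl p) :=
  Projectivization.map (vecToAlgCl p) (vecToAlgCl_injective p)

/-- The `p`-adic logarithm `∑_{n ≥ 1} (-1)^{n-1} (x-1)^n / n`, used for `|x - 1|_p < 1`. -/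
def padicLog (x : PadicAlgCl p) : PadicAlgCl p :=
  ∑' n : ℕ, (-1) ^ n * (x - 1) ^ (n + 1) / ((n : PadicAlgCl p) + 1)

variable {p}

/-- The matrix over `ℚ_p` defined by a matrix over `ℤ_p`. -/
def toPadicGL (A : Matrix.GeneralLinearGroup (Fin 2) ℤ_[p]) :
    Matrix.GeneralLinearGroup (Fin 2) ℚ_[p] :=
  Matrix.GeneralLinearGroup.map PadicInt.Coe.ringHom A

/-- The endomorphism of `(ℚ̄_p)²` defined by a matrix over `ℤ_p`. -/
def algClEnd (A : Matrix.GeneralLinearGroup (Fin 2) ℤ_[p]) :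
    Module.End (PadicAlgCl p) (Fin 2 → PadicAlgCl p) :=
  Matrix.toLin' ((A : Matrix (Fin 2) (Fin 2) ℤ_[p]).map
    fun a => algebraMap ℚ_[p] (PadicAlgCl p) (a : ℚ_[p]))

/-- `w`, a point of the projective line over `ℚ̄_p`, is an eigenvector of `A`. -/
def IsEigenpoint (A : Matrix.GeneralLinearGroup (Fin 2) ℤ_[p]) (w : ProjLine (PadicAlgCl p)) :
    Prop :=
  ∃ μ : PadicAlgCl p, (algClEnd A).HasEigenvector μ w.rep

/-- `κ` is an admissible value of `κ(A)`: a positive integer, at most `p²`, such that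
`|λ^κ - 1|_p ≤ p⁻¹` for each eigenvalue `λ` of `A`. -/
def IsKappa (A : Matrix.GeneralLinearGroup (Fin 2) ℤ_[p]) (κ : ℕ) : Prop :=
  0 < κ ∧ κ ≤ p ^ 2 ∧
    ∀ μ : PadicAlgCl p, (algClEnd A).HasEigenvalue μ → ‖μ ^ κ - 1‖ ≤ (p : ℝ)⁻¹

/-- The set `SL₂^±(ℤ_p)` of matrices of determinant `±1`. -/
def SLpm (p : ℕ) [Fact p.Prime] : Set (Matrix.GeneralLinearGroup (Fin 2) ℤ_[p]) :=
  {A | (A : Matrix (Fin 2) (Fin 2) ℤ_[p]).det = 1 ∨ (A : Matrix (Fin 2) (Fin 2) ℤ_[p]).det = -1}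

/-- The matrices in `SL₂^±(ℤ_p)` with two different eigenvectors in the projective line
over `ℚ̄_p`. -/
def SLpmOne (p : ℕ) [Fact p.Prime] : Set (Matrix.GeneralLinearGroup (Fin 2) ℤ_[p]) :=
  {A | A ∈ SLpm p ∧ ∃ w₁ w₂, w₁ ≠ w₂ ∧ IsEigenpoint A w₁ ∧ IsEigenpoint A w₂}

/-- Membership of `A` in the set `S̃L₂(ℤ_p)`, where `κ` is the value of `κ(A)`. -/
def MemSLTilde (A : Matrix.GeneralLinearGroup (Fin 2) ℤ_[p]) (κ : ℕ) : Prop :=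
  A ∈ SLpmOne p ∧
    ∀ μ : PadicAlgCl p, (algClEnd A).HasEigenvalue μ → padicLog p (μ ^ κ) ≠ 0

end AlgebraicClosure

end

/-
Let `v` be primitive integral coordinates of `x_p` and put `B = (Aᵀ) ^ (2 * κ)`. Expanding `v` in
the eigenvectors of `B` gives `|B ^ t v ∧ B ^ s v| = ρ |t - s|` for all `t` and `s`, where
`ρ = ε₁ ε₂ ε₃ / d(w₁, w₂)`: the eigenvalues of `B ^ 2` are so close to `1` that taking `n`-th powers
multiplies their distance to `1` by exactly `|n|`, and that distance is `ε₃`. The iterates of `x_p`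
under `B` are therefore evenly spread over a residue disc, and one of the first few of them is
nearly a zero of some integral form `a q₁ + b q₂` with small coefficients. The shift orbit of `x`
comes close to this iterate, where the form is too small for a point of `PBad`.
-/

open Filter Topology

section PadicAnalysis

theorem summable_add_one_mul_pow {r : ℝ} (hr₀ : 0 ≤ r) (hr : r < 1) :
    Summable fun k : ℕ => ((k : ℝ) + 1) * r ^ (k + 1) := by
  have h := summable_pow_mul_geometric_of_norm_lt_one 1 (r := r) (by rwa [Real.norm_of_nonneg hr₀])
  simpa using (summable_nat_add_iff 1).mpr h

theorem add_two_mul_pow_le {r : ℝ} (hr₀ : 0 ≤ r) (hr : r ≤ 1 / 2) (k : ℕ) :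
    ((k : ℝ) + 2) * r ^ (k + 1) ≤ 2 * r := by
  have hk : (k : ℝ) + 2 ≤ 2 ^ (k + 1) := by exact_mod_cast (k + 1).lt_two_pow_self
  calc ((k : ℝ) + 2) * r ^ (k + 1) ≤ 2 ^ (k + 1) * r ^ (k + 1) := by gcongr
    _ = (2 * r) ^ (k + 1) := (mul_pow _ _ _).symm
    _ ≤ 2 * r := pow_le_of_le_one (by positivity) (by linarith) k.succ_ne_zero

theorem norm_le_one_of_norm_sub_one_le_one {F : Type*} [NormedField F] [IsUltrametricDist F] {x : F}
    (hx : ‖x - 1‖ ≤ 1) : ‖x‖ ≤ 1 := by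
  simpa only [sub_add_cancel, norm_one] using
    (IsUltrametricDist.norm_add_le_max (x - 1) 1).trans (max_le hx norm_one.le)

theorem norm_pow_sub_one_le {F : Type*} [NormedField F] [IsUltrametricDist F] {x : F}
    (hx : ‖x‖ ≤ 1) (n : ℕ) : ‖x ^ n - 1‖ ≤ ‖x - 1‖ := by
  rw [← mul_geom_sum, norm_mul]
  refine mul_le_of_le_one_right (norm_nonneg _) ?_
  refine IsUltrametricDist.norm_sum_le_of_forall_le_of_nonneg zero_le_one fun i _ => ?_
  rw [norm_pow]
  exact pow_le_one₀ (norm_nonneg _) hx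

theorem norm_add_eq_right_of_norm_le_mul {E : Type*} [NormedAddCommGroup E] [IsUltrametricDist E]
    {x y : E} {c : ℝ} (hc : c < 1) (h : ‖x‖ ≤ c * ‖y‖) : ‖x + y‖ = ‖y‖ := by
  rcases eq_or_ne y 0 with rfl | hy
  · rw [norm_zero, mul_zero, norm_le_zero_iff] at h
    rw [h, add_zero]
  · have hlt : ‖x‖ < ‖y‖ := h.trans_lt (mul_lt_of_lt_one_left (norm_pos_iff.mpr hy) hc)
    rw [IsUltrametricDist.norm_add_eq_max_of_norm_ne_norm hlt.ne, max_eq_right hlt.le]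

theorem one_add_pow_succ_sub_one_div {F : Type*} [Field F] [CharZero F] (u : F) (n : ℕ) :
    ((1 + u) ^ (n + 1) - 1) / ((n : F) + 1) =
      ∑ k ∈ Finset.range (n + 1), (n.choose k : F) * u ^ (k + 1) / ((k : F) + 1) := by
  rw [div_eq_iff (Nat.cast_add_one_ne_zero n), add_comm 1 u, add_pow, Finset.sum_range_succ',
    Finset.sum_mul]
  simp only [one_pow, mul_one, pow_zero, Nat.choose_zero_right, Nat.cast_one, add_sub_cancel_right]
  refine Finset.sum_congr rfl fun k _ => ?_
  have hchoose : ((n : F) + 1) * n.choose k = (n + 1).choose (k + 1) * ((k : F) + 1) := by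
    exact_mod_cast Nat.add_one_mul_choose_eq n k
  rw [div_mul_eq_mul_div, eq_div_iff (Nat.cast_add_one_ne_zero k)]
  linear_combination - u ^ (k + 1) * hchoose

variable (p : ℕ) [Fact p.Prime] {K : Type*} [NormedField K] [NormedAlgebra ℚ_[p] K]

include p

theorem norm_natCast_of_normedAlgebra_padic (n : ℕ) : ‖(n : K)‖ = ‖(n : ℚ_[p])‖ := by
  rw [← norm_algebraMap' K (n : ℚ_[p]), map_natCast]

theorem norm_natCast_le_one_of_normedAlgebra_padic (n : ℕ) : ‖(n : K)‖ ≤ 1 := by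
  rw [norm_natCast_of_normedAlgebra_padic p]
  exact_mod_cast Padic.norm_int_le_one (p := p) n

theorem one_le_natCast_mul_norm_natCast {n : ℕ} (hn : n ≠ 0) : 1 ≤ (n : ℝ) * ‖(n : K)‖ := by
  have hp : (0 : ℝ) < p := mod_cast (Fact.out : p.Prime).pos
  rw [norm_natCast_of_normedAlgebra_padic p, Padic.norm_eq_zpow_neg_valuation (mod_cast hn),
    Padic.valuation_natCast, zpow_neg, zpow_natCast, ← div_eq_mul_inv, one_le_div (by positivity)]
  exact_mod_cast Nat.le_of_dvd (Nat.pos_of_ne_zero hn) pow_padicValNat_dvd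

theorem charZero_of_normedAlgebra_padic : CharZero K :=
  charZero_of_injective_algebraMap (algebraMap ℚ_[p] K).injective

theorem norm_mul_pow_div_le {c : K} (hc : ‖c‖ ≤ 1) (u : K) (k : ℕ) :
    ‖c * u ^ (k + 1) / ((k : K) + 1)‖ ≤ ((k : ℝ) + 1) * ‖u‖ ^ (k + 1) := by
  have hk := one_le_natCast_mul_norm_natCast p (K := K) k.succ_ne_zero
  have hk0 : 0 < ‖((k + 1 : ℕ) : K)‖ := pos_of_mul_pos_right (one_pos.trans_le hk) (by positivity)
  push_cast at hk hk0
  rw [norm_div, norm_mul, norm_pow, div_le_iff₀ hk0]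
  calc ‖c‖ * ‖u‖ ^ (k + 1) ≤ 1 * ‖u‖ ^ (k + 1) := by gcongr
    _ ≤ (((k : ℝ) + 1) * ‖(k : K) + 1‖) * ‖u‖ ^ (k + 1) := by gcongr
    _ = ((k : ℝ) + 1) * ‖u‖ ^ (k + 1) * ‖(k : K) + 1‖ := by ring

theorem norm_one_add_pow_sub_one [IsUltrametricDist K] {u : K} (hu : ‖u‖ < 1 / 2) (n : ℕ) :
    ‖(1 + u) ^ n - 1‖ = ‖(n : K)‖ * ‖u‖ := by
  have := charZero_of_normedAlgebra_padic p (K := K)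
  rcases n with _ | n
  · simp
  rw [← mul_div_cancel₀ ((1 + u) ^ (n + 1) - 1) (Nat.cast_add_one_ne_zero (R := K) n), norm_mul,
    one_add_pow_succ_sub_one_div, Finset.sum_range_succ', Nat.cast_succ]
  congr 1
  simp only [Nat.choose_zero_right, Nat.cast_one, zero_add, pow_one, one_mul, Nat.cast_zero,
    div_one]
  refine norm_add_eq_right_of_norm_le_mul (c := 2 * ‖u‖) (by linarith) ?_
  refine IsUltrametricDist.norm_sum_le_of_forall_le_of_nonneg (by positivity) fun k _ => ?_
  calc _ ≤ _ := norm_mul_pow_div_le p (norm_natCast_le_one_of_normedAlgebra_padic p _) u (k + 1)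
    _ = ((k : ℝ) + 2) * ‖u‖ ^ (k + 1) * ‖u‖ := by push_cast; ring
    _ ≤ 2 * ‖u‖ * ‖u‖ := by
      exact mul_le_mul_of_nonneg_right (add_two_mul_pow_le (norm_nonneg u) hu.le k) (norm_nonneg u)

theorem tendsto_natCast_prime_pow : Tendsto (fun n : ℕ => (p : K) ^ n) atTop (𝓝 0) := by
  refine tendsto_pow_atTop_nhds_zero_of_norm_lt_one ?_
  rw [norm_natCast_of_normedAlgebra_padic p]
  exact Padic.norm_p_lt_one

theorem tendsto_choose_prime_pow_sub_one (k : ℕ) :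
    Tendsto (fun n : ℕ => ((p ^ n - 1).choose k : K)) atTop (𝓝 ((-1) ^ k)) := by
  have := charZero_of_normedAlgebra_padic p (K := K)
  induction k with
  | zero => simp
  | succ k ih =>
    have hrec (n : ℕ) : ((p ^ n - 1).choose (k + 1) : K) =
        (p : K) ^ n * (p ^ n - 1).choose k / ((k : K) + 1) - (p ^ n - 1).choose k := by
      obtain ⟨N, hN⟩ := Nat.exists_eq_add_one.mpr (pow_pos (Fact.out : p.Prime).pos n)
      have hchoose : ((N : K) + 1) * N.choose k =
          (N.choose k + N.choose (k + 1)) * ((k : K) + 1) := by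
        exact_mod_cast N.choose_succ_succ k ▸ Nat.add_one_mul_choose_eq N k
      rw [← Nat.cast_pow, hN, Nat.add_sub_cancel, Nat.cast_succ, hchoose,
        mul_div_cancel_right₀ _ (Nat.cast_add_one_ne_zero k), add_sub_cancel_left]
    simp only [hrec]
    convert (((tendsto_natCast_prime_pow p).mul ih).div_const ((k : K) + 1)).sub ih using 2
    ring

theorem summable_log_series [CompleteSpace K] {u : K} (hu : ‖u‖ < 1) :
    Summable fun k : ℕ => (-1) ^ k * u ^ (k + 1) / ((k : K) + 1) :=
  .of_norm_bounded (summable_add_one_mul_pow (norm_nonneg u) hu) fun k =>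
    norm_mul_pow_div_le p (by simp) u k

theorem tendsto_one_add_pow_prime_pow_sub_one_div [CompleteSpace K] {u : K} (hu : ‖u‖ < 1) :
    Tendsto (fun n : ℕ => ((1 + u) ^ p ^ n - 1) / (p : K) ^ n) atTop
      (𝓝 (∑' k : ℕ, (-1) ^ k * u ^ (k + 1) / ((k : K) + 1))) := by
  have := charZero_of_normedAlgebra_padic p (K := K)
  have hsum (n : ℕ) : ((1 + u) ^ p ^ n - 1) / (p : K) ^ n =
      ∑' k : ℕ, ((p ^ n - 1).choose k : K) * u ^ (k + 1) / ((k : K) + 1) := by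
    obtain ⟨N, hN⟩ := Nat.exists_eq_add_one.mpr (pow_pos (Fact.out : p.Prime).pos n)
    rw [← Nat.cast_pow, hN, Nat.add_sub_cancel, Nat.cast_succ, one_add_pow_succ_sub_one_div]
    refine (tsum_eq_sum fun k hk => ?_).symm
    rw [Nat.choose_eq_zero_of_lt (by simpa using hk), Nat.cast_zero, zero_mul, zero_div]
  simp only [hsum]
  exact tendsto_tsum_of_dominated_convergence (summable_add_one_mul_pow (norm_nonneg u) hu)
    (fun k => ((tendsto_choose_prime_pow_sub_one p k).mul_const _).div_const _) <|
    .of_forall fun n k => norm_mul_pow_div_le p (norm_natCast_le_one_of_normedAlgebra_padic p _) u k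

end PadicAnalysis

section PadicLog

variable {p : ℕ} [Fact p.Prime]

/- The log series takes its values in a finite, hence complete, extension of `ℚ_[p]`. -/
theorem tendsto_pow_prime_pow_sub_one_div_padicLog {x : PadicAlgCl p} (hx : ‖x - 1‖ < 1) :
    Tendsto (fun n : ℕ => (x ^ p ^ n - 1) / (p : PadicAlgCl p) ^ n) atTop (𝓝 (padicLog p x)) := by
  let F := IntermediateField.adjoin ℚ_[p] {x}
  have : FiniteDimensional ℚ_[p] F :=
    IntermediateField.adjoin.finiteDimensional (Algebra.IsIntegral.isIntegral x)
  have : CompleteSpace F := FiniteDimensional.complete ℚ_[p] F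
  let u : F := ⟨x, IntermediateField.mem_adjoin_simple_self _ x⟩ - 1
  have hu : ‖u‖ < 1 := hx
  have hlog : ((∑' k : ℕ, (-1) ^ k * u ^ (k + 1) / ((k : F) + 1) : F) : PadicAlgCl p) =
      padicLog p x :=
    ((summable_log_series p hu).hasSum.map F.val continuous_subtype_val).tsum_eq.symm.trans <|
      tsum_congr fun k => by simp [u]
  rw [← hlog]
  convert (continuous_subtype_val.tendsto _).comp
    (tendsto_one_add_pow_prime_pow_sub_one_div p hu) using 2 with n
  simp [u]

theorem norm_padicLog {x : PadicAlgCl p} (hx : ‖x - 1‖ < 1 / 2) : ‖padicLog p x‖ = ‖x - 1‖ := by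
  refine tendsto_nhds_unique
    (tendsto_pow_prime_pow_sub_one_div_padicLog (hx.trans one_half_lt_one)).norm ?_
  convert tendsto_const_nhds using 2 with n
  have hp : ‖(p : PadicAlgCl p) ^ n‖ ≠ 0 := norm_ne_zero_iff.mpr <|
    pow_ne_zero n <| Nat.cast_ne_zero.mpr (Fact.out : p.Prime).ne_zero
  rw [norm_div, ← add_sub_cancel 1 x, norm_one_add_pow_sub_one p hx, Nat.cast_pow,
    mul_div_cancel_left₀ _ hp, add_sub_cancel]

theorem padicLog_pow {x : PadicAlgCl p} (hx : ‖x - 1‖ < 1) (m : ℕ) :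
    padicLog p (x ^ m) = m * padicLog p x := by
  have hlog := tendsto_pow_prime_pow_sub_one_div_padicLog hx
  have hone : Tendsto (fun n : ℕ => x ^ p ^ n) atTop (𝓝 1) := by
    rw [← tendsto_sub_nhds_zero_iff, ← zero_mul (padicLog p x)]
    exact ((tendsto_natCast_prime_pow p).mul hlog).congr fun n => mul_div_cancel₀ _ <|
      pow_ne_zero n <| Nat.cast_ne_zero.mpr (Fact.out : p.Prime).ne_zero
  have hgeom : Tendsto (fun n : ℕ => ∑ i ∈ Finset.range m, (x ^ p ^ n) ^ i) atTop
      (𝓝 (m : PadicAlgCl p)) := by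
    simpa using tendsto_finsetSum (Finset.range m) fun i _ => hone.pow i
  have hx1 : ‖x‖ ≤ 1 := norm_le_one_of_norm_sub_one_le_one hx.le
  refine tendsto_nhds_unique (tendsto_pow_prime_pow_sub_one_div_padicLog
    ((norm_pow_sub_one_le hx1 m).trans_lt hx)) ?_
  refine (hgeom.mul hlog).congr fun n => ?_
  rw [← mul_div_assoc, geom_sum_mul, pow_right_comm]

theorem padicLog_pow_ne_zero {x : PadicAlgCl p} (hx : ‖x - 1‖ < 1) {m : ℕ} (hm : m ≠ 0)
    (h : padicLog p x ≠ 0) : padicLog p (x ^ m) ≠ 0 := by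
  have := charZero_of_normedAlgebra_padic p (K := PadicAlgCl p)
  rw [padicLog_pow hx]
  exact mul_ne_zero (Nat.cast_ne_zero.mpr hm) h

end PadicLog

section EigenvaluePowers

variable (p : ℕ) [Fact p.Prime] {K : Type*} [NormedField K] [NormedAlgebra ℚ_[p] K]
  [IsUltrametricDist K]

include p

theorem norm_pow_four_sub_one_lt {y : K} (hy : ‖y - 1‖ ≤ (p : ℝ)⁻¹) : ‖y ^ 4 - 1‖ < 1 / 2 := by
  have hp : p.Prime := Fact.out
  have hy1 : ‖y‖ ≤ 1 := norm_le_one_of_norm_sub_one_le_one <| hy.trans <|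
    inv_le_one_of_one_le₀ <| mod_cast hp.one_le
  rcases hp.two_le.eq_or_lt with rfl | hp2
  · have htwo : ‖(2 : K)‖ = 1 / 2 := by
      simpa using (norm_natCast_of_normedAlgebra_padic 2 (K := K) 2).trans Padic.norm_p
    have hadd (z : K) (hz : ‖z - 1‖ ≤ 1 / 2) : ‖z + 1‖ ≤ 1 / 2 := by
      simpa [show z + 1 = z - 1 + 2 by ring] using
        (IsUltrametricDist.norm_add_le_max (z - 1) 2).trans (max_le hz htwo.le)
    have hy2 : ‖y - 1‖ ≤ 1 / 2 := by simpa using hy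
    calc ‖y ^ 4 - 1‖ = ‖y - 1‖ * ‖y + 1‖ * ‖y ^ 2 + 1‖ := by
          rw [← norm_mul, ← norm_mul]; ring_nf
      _ ≤ 1 / 2 * (1 / 2) * (1 / 2) := by
          gcongr
          exacts [hadd y hy2, hadd _ ((norm_pow_sub_one_le hy1 2).trans hy2)]
      _ < 1 / 2 := by norm_num
  · calc ‖y ^ 4 - 1‖ ≤ (p : ℝ)⁻¹ := (norm_pow_sub_one_le hy1 4).trans hy
      _ < 2⁻¹ := inv_strictAnti₀ two_pos (mod_cast hp2)
      _ = 1 / 2 := inv_eq_one_div 2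

theorem norm_pow_mul_pow_sub {P Q : K} (hPQ : P * Q = 1) (hP : ‖P ^ 2 - 1‖ < 1 / 2) (t s : ℕ) :
    ‖P ^ t * Q ^ s - P ^ s * Q ^ t‖ = ‖(t : ℚ_[p]) - s‖ * ‖P ^ 2 - 1‖ := by
  wlog h : s ≤ t generalizing t s
  · rw [norm_sub_rev, this s t (by omega), norm_sub_rev]
  obtain ⟨n, rfl⟩ := Nat.exists_eq_add_of_le h
  have hP1 : ‖P‖ = 1 := by
    have hsq : ‖P ^ 2 - 1 + 1‖ = ‖(1 : K)‖ :=
      norm_add_eq_right_of_norm_le_mul one_half_lt_one (by rw [norm_one]; linarith)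
    rwa [sub_add_cancel, norm_one, norm_pow, pow_eq_one_iff_of_nonneg (norm_nonneg _) two_ne_zero]
      at hsq
  have hQ1 : ‖Q‖ = 1 := by
    rw [← one_mul ‖Q‖, ← hP1, ← norm_mul, hPQ, norm_one, hP1]
  have hfactor : P ^ (s + n) * Q ^ s - P ^ s * Q ^ (s + n) =
      Q ^ n * ((1 + (P ^ 2 - 1)) ^ n - 1) := by
    have hs : P ^ s * Q ^ s = 1 := by rw [← mul_pow, hPQ, one_pow]
    have hn : P ^ n * Q ^ n = 1 := by rw [← mul_pow, hPQ, one_pow]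
    rw [add_sub_cancel, ← pow_mul, two_mul, pow_add, pow_add, pow_add]
    linear_combination (P ^ n - Q ^ n) * hs - P ^ n * hn
  rw [hfactor, norm_mul, norm_pow, hQ1, one_pow, one_mul, norm_one_add_pow_sub_one p hP,
    norm_natCast_of_normedAlgebra_padic p, Nat.cast_add, add_sub_cancel_left]

end EigenvaluePowers

section Wedge

variable {R : Type*} [CommRing R]

/-- The determinant of a pair of plane vectors. On homogeneous coordinates over a normed field its
norm is the numerator of `projDist`. -/
def wedge (v w : Fin 2 → R) : R := v 0 * w 1 - v 1 * w 0

theorem map_wedge {S : Type*} [CommRing S] (f : R →+* S) (v w : Fin 2 → R) :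
    f (wedge v w) = wedge (f ∘ v) (f ∘ w) := by
  simp [wedge]

theorem wedge_smul_eq (v w₁ w₂ : Fin 2 → R) :
    wedge w₁ w₂ • v = wedge v w₂ • w₁ - wedge v w₁ • w₂ := by
  ext i
  fin_cases i <;> simp [wedge] <;> ring

theorem wedge_map (f : Module.End R (Fin 2 → R)) (v w : Fin 2 → R) :
    wedge (f v) (f w) = LinearMap.det f * wedge v w := by
  obtain ⟨M, rfl⟩ := Matrix.toLin'.surjective f
  simp only [wedge, LinearMap.det_toLin', Matrix.det_fin_two, Matrix.toLin'_apply,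
    Matrix.mulVec_fin_two, Matrix.cons_val_zero, Matrix.cons_val_one]
  ring

variable [IsDomain R] {f : Module.End R (Fin 2 → R)} {μ₁ μ₂ : R} {w₁ w₂ : Fin 2 → R}

theorem det_eq_mul_of_hasEigenvector (h₁ : f.HasEigenvector μ₁ w₁) (h₂ : f.HasEigenvector μ₂ w₂)
    (hw : wedge w₁ w₂ ≠ 0) : LinearMap.det f = μ₁ * μ₂ := by
  refine mul_right_cancel₀ hw ?_
  rw [← wedge_map, h₁.apply_eq_smul, h₂.apply_eq_smul]
  simp only [wedge, Pi.smul_apply, smul_eq_mul]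
  ring

theorem eq_or_eq_of_hasEigenvalue (h₁ : f.HasEigenvector μ₁ w₁) (h₂ : f.HasEigenvector μ₂ w₂)
    (hw : wedge w₁ w₂ ≠ 0) (hf : LinearMap.det f ≠ 0) {μ : R} (hμ : f.HasEigenvalue μ) :
    μ = μ₁ ∨ μ = μ₂ := by
  have hdet := det_eq_mul_of_hasEigenvector h₁ h₂ hw
  rw [hdet] at hf
  obtain ⟨v, hv⟩ := hμ.exists_hasEigenvector
  by_cases hv₂ : wedge v w₂ = 0
  · by_cases hv₁ : wedge v w₁ = 0
    · have := wedge_smul_eq v w₁ w₂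
      rw [hv₁, hv₂, zero_smul, zero_smul, sub_zero] at this
      exact absurd this (smul_ne_zero hw hv.2)
    · refine .inr (mul_right_cancel₀ (left_ne_zero_of_mul hf) ?_)
      rw [← det_eq_mul_of_hasEigenvector hv h₁ hv₁, hdet, mul_comm]
  · refine .inl (mul_right_cancel₀ (right_ne_zero_of_mul hf) ?_)
    rw [← det_eq_mul_of_hasEigenvector hv h₂ hv₂, hdet]

theorem wedge_mul_wedge_pow_apply (h₁ : f.HasEigenvector μ₁ w₁) (h₂ : f.HasEigenvector μ₂ w₂)
    (hw : wedge w₁ w₂ ≠ 0) (v : Fin 2 → R) (t s : ℕ) :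
    wedge w₁ w₂ * wedge ((f ^ t) v) ((f ^ s) v) =
      wedge v w₁ * wedge v w₂ * (μ₁ ^ s * μ₂ ^ t - μ₁ ^ t * μ₂ ^ s) := by
  have happly (n : ℕ) : wedge w₁ w₂ • (f ^ n) v =
      (wedge v w₂ * μ₁ ^ n) • w₁ - (wedge v w₁ * μ₂ ^ n) • w₂ := by
    rw [← map_smul, wedge_smul_eq, map_sub, map_smul, map_smul, h₁.pow_apply, h₂.pow_apply,
      smul_smul, smul_smul]
  have hsmul (c d : R) (x y : Fin 2 → R) : wedge (c • x) (d • y) = c * d * wedge x y := by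
    simp only [wedge, Pi.smul_apply, smul_eq_mul]; ring
  refine mul_left_cancel₀ hw ?_
  rw [← mul_assoc, ← hsmul, happly, happly]
  generalize wedge v w₁ = a
  generalize wedge v w₂ = b
  simp only [wedge, Pi.smul_apply, Pi.sub_apply, smul_eq_mul]
  ring

end Wedge

section ProjectiveMetric

variable {K : Type*} [NormedField K]

theorem vecHeight_eq_norm (x : Fin 2 → K) : vecHeight x = ‖x‖ :=
  le_antisymm (max_le (norm_le_pi_norm x 0) (norm_le_pi_norm x 1)) <|
    (pi_norm_le_iff_of_nonneg (le_max_of_le_left (norm_nonneg _))).mpr <|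
      Fin.forall_fin_two.mpr ⟨le_max_left _ _, le_max_right _ _⟩

theorem projDist_eq_norm_wedge_div (v w : ProjLine K) :
    projDist v w = ‖wedge v.rep w.rep‖ / (‖v.rep‖ * ‖w.rep‖) := by
  rw [projDist, vecHeight_eq_norm, vecHeight_eq_norm, wedge]

theorem projDist_mk_left (v : Fin 2 → K) (hv : v ≠ 0) (w : ProjLine K) :
    projDist (.mk K v hv) w = ‖wedge v w.rep‖ / (‖v‖ * ‖w.rep‖) := by
  conv_lhs => rw [← w.mk_rep]
  rw [projDist_mk, vecHeight_eq_norm, vecHeight_eq_norm, wedge]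

theorem wedge_rep_ne_zero {v w : ProjLine K} (h : v ≠ w) : wedge v.rep w.rep ≠ 0 := by
  contrapose! h
  have hcomm : ∀ i j, v.rep i * w.rep j = v.rep j * w.rep i := by
    simp [Fin.forall_fin_two, sub_eq_zero.mp h]
  obtain ⟨i, hi⟩ := Function.ne_iff.mp w.rep_nonzero
  rw [← v.mk_rep, ← w.mk_rep, Projectivization.mk_eq_mk_iff']
  refine ⟨v.rep i / w.rep i, funext fun j => ?_⟩
  rw [Pi.smul_apply, smul_eq_mul, div_mul_eq_mul_div, hcomm, mul_div_cancel_right₀ _ hi]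

theorem projDist_pos {v w : ProjLine K} (h : v ≠ w) : 0 < projDist v w := by
  rw [projDist_eq_norm_wedge_div]
  have := norm_pos_iff.mpr v.rep_nonzero
  have := norm_pos_iff.mpr w.rep_nonzero
  have := norm_pos_iff.mpr (wedge_rep_ne_zero h)
  positivity

theorem projDist_nonneg (v w : ProjLine K) : 0 ≤ projDist v w := by
  rw [projDist_eq_norm_wedge_div]
  positivity

variable [IsUltrametricDist K]

theorem norm_wedge_mul_norm_le (x v w : Fin 2 → K) :
    ‖wedge v w‖ * ‖x‖ ≤ max (‖wedge x w‖ * ‖v‖) (‖wedge x v‖ * ‖w‖) := by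
  calc ‖wedge v w‖ * ‖x‖ = ‖wedge x w • v - wedge x v • w‖ := by rw [← norm_smul, wedge_smul_eq]
    _ ≤ max ‖wedge x w • v‖ ‖wedge x v • w‖ := by
        simpa only [sub_eq_add_neg, norm_neg] using
          IsUltrametricDist.norm_add_le_max (wedge x w • v) (-(wedge x v • w))
    _ = max (‖wedge x w‖ * ‖v‖) (‖wedge x v‖ * ‖w‖) := by rw [norm_smul, norm_smul]

theorem projDist_le_max (x v w : ProjLine K) :
    projDist v w ≤ max (projDist x v) (projDist x w) := by
  have hx := norm_pos_iff.mpr x.rep_nonzero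
  have hv := norm_pos_iff.mpr v.rep_nonzero
  have hw := norm_pos_iff.mpr w.rep_nonzero
  simp only [projDist_eq_norm_wedge_div]
  rw [le_max_iff, div_le_div_iff₀ (by positivity) (by positivity),
    div_le_div_iff₀ (by positivity) (by positivity)]
  rcases le_max_iff.mp (norm_wedge_mul_norm_le x.rep v.rep w.rep) with h | h
  · exact .inr (by linarith [mul_le_mul_of_nonneg_right h hw.le])
  · exact .inl (by linarith [mul_le_mul_of_nonneg_right h hv.le])

theorem min_projDist_mul_projDist_le (x v w : ProjLine K) :
    min (projDist x v) (projDist x w) * projDist v w ≤ projDist x v * projDist x w := by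
  rw [← min_mul_max (projDist x v)]
  exact mul_le_mul_of_nonneg_left (projDist_le_max x v w)
    (le_min (projDist_nonneg _ _) (projDist_nonneg _ _))

end ProjectiveMetric

section IntegralCoordinates

variable {p : ℕ} [Fact p.Prime]

theorem norm_comp_eq {ι E F : Type*} [Fintype ι] [SeminormedAddGroup E] [SeminormedAddGroup F]
    {f : E → F} (hf : ∀ x, ‖f x‖ = ‖x‖) (v : ι → E) : ‖f ∘ v‖ = ‖v‖ := by
  have hf' (x : E) : ‖f x‖₊ = ‖x‖₊ := NNReal.eq (hf x)
  simp only [Pi.norm_def, Function.comp_apply, hf']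

/-- `v` is a pair of homogeneous coordinates of `x` in `ℤ_p`, at least one of them a unit; the
latter is expressed by the supremum norm of `v`. -/
def IsPrimitiveRep (v : Fin 2 → ℤ_[p]) (x : ProjLine ℚ_[p]) : Prop :=
  ‖v‖ = 1 ∧ ∃ hv : ((↑) ∘ v : Fin 2 → ℚ_[p]) ≠ 0, x = .mk ℚ_[p] ((↑) ∘ v) hv

theorem exists_isPrimitiveRep (x : ProjLine ℚ_[p]) : ∃ v, IsPrimitiveRep v x := by
  obtain ⟨i, hmax⟩ := Finite.exists_max fun i => ‖x.rep i‖
  have hnorm : ‖x.rep‖ = ‖x.rep i‖ :=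
    le_antisymm ((pi_norm_le_iff_of_nonneg (norm_nonneg _)).mpr hmax) (norm_le_pi_norm _ i)
  have hi : x.rep i ≠ 0 := norm_ne_zero_iff.mp (hnorm ▸ norm_ne_zero_iff.mpr x.rep_nonzero)
  have hle (j : Fin 2) : ‖(x.rep i)⁻¹ * x.rep j‖ ≤ 1 := by
    rw [norm_mul, norm_inv, inv_mul_le_one₀ (norm_pos_iff.mpr hi)]
    exact hmax j
  let v : Fin 2 → ℤ_[p] := fun j => ⟨(x.rep i)⁻¹ * x.rep j, hle j⟩
  have hv : ((↑) ∘ v : Fin 2 → ℚ_[p]) = (x.rep i)⁻¹ • x.rep := rfl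
  refine ⟨v, ?_, hv ▸ smul_ne_zero (inv_ne_zero hi) x.rep_nonzero, ?_⟩
  · rw [← norm_comp_eq (E := ℤ_[p]) (f := ((↑) : ℤ_[p] → ℚ_[p])) (fun _ => rfl) v,
      hv, norm_smul, norm_inv, hnorm, inv_mul_cancel₀ (norm_ne_zero_iff.mpr hi)]
  · conv_lhs => rw [← x.mk_rep]
    exact (Projectivization.mk_eq_mk_iff' ..).mpr ⟨x.rep i, by rw [hv, smul_inv_smul₀ hi]⟩

theorem norm_mulVec_le (M : Matrix (Fin 2) (Fin 2) ℤ_[p]) (v : Fin 2 → ℤ_[p]) :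
    ‖M.mulVec v‖ ≤ ‖v‖ := by
  refine (pi_norm_le_iff_of_nonneg (norm_nonneg v)).mpr fun i => ?_
  refine IsUltrametricDist.norm_sum_le_of_forall_le_of_nonneg (s := Finset.univ)
    (f := fun j => M i j * v j) (norm_nonneg v) fun j _ => ?_
  rw [norm_mul]
  exact (mul_le_of_le_one_left (norm_nonneg _) (M i j).norm_le_one).trans (norm_le_pi_norm v j)

theorem norm_mulVec_eq (A : Matrix.GeneralLinearGroup (Fin 2) ℤ_[p]) (v : Fin 2 → ℤ_[p]) :
    ‖A.val.mulVec v‖ = ‖v‖ := by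
  refine le_antisymm (norm_mulVec_le _ v) ?_
  calc ‖v‖ = ‖(A⁻¹).val.mulVec (A.val.mulVec v)‖ := by
        rw [Matrix.mulVec_mulVec, ← Units.val_mul, inv_mul_cancel, Units.val_one, Matrix.one_mulVec]
    _ ≤ ‖A.val.mulVec v‖ := norm_mulVec_le _ _

namespace IsPrimitiveRep

variable {v : Fin 2 → ℤ_[p]} {x : ProjLine ℚ_[p]}

theorem smul (hv : IsPrimitiveRep v x) (A : Matrix.GeneralLinearGroup (Fin 2) ℤ_[p]) :
    IsPrimitiveRep (A.val.mulVec v) (toPadicGL A • x) := by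
  obtain ⟨hnorm, hv0, rfl⟩ := hv
  have hcomp : (toPadicGL A).val.mulVec ((↑) ∘ v) = ((↑) ∘ A.val.mulVec v : Fin 2 → ℚ_[p]) :=
    funext fun i => (PadicInt.Coe.ringHom.map_mulVec A.val v i).symm
  have hsmul : toPadicGL A • ((↑) ∘ v : Fin 2 → ℚ_[p]) = (↑) ∘ A.val.mulVec v := hcomp
  refine ⟨(norm_mulVec_eq A v).trans hnorm, hsmul ▸ (smul_ne_zero_iff_ne _).mpr hv0, ?_⟩
  simp only [Projectivization.smul_mk, hsmul]

theorem norm_form_div_le (hv : IsPrimitiveRep v x) {y : ProjLine ℚ_[p]} {r : ℝ}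
    (hy : projDist x y ≤ r) {a b : ℤ} (hab : ‖(a : ℤ_[p]) * v 0 + b * v 1‖ ≤ r) :
    ‖(a : ℚ_[p]) * y.rep 0 + b * y.rep 1‖ / vecHeight y.rep ≤ r := by
  obtain ⟨hnorm, hv0, rfl⟩ := hv
  set v' : Fin 2 → ℚ_[p] := (↑) ∘ v
  have hv' : ‖v'‖ = 1 := (norm_comp_eq (fun _ => rfl) v).trans hnorm
  have hpos := norm_pos_iff.mpr y.rep_nonzero
  rw [projDist_mk_left, hv', one_mul, div_le_iff₀ hpos] at hy
  rw [vecHeight_eq_norm, div_le_iff₀ hpos]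
  let z : Fin 2 → ℚ_[p] := ![-b, a]
  have hz : ‖z‖ ≤ 1 := (pi_norm_le_iff_of_nonneg zero_le_one).mpr <| Fin.forall_fin_two.mpr
    ⟨(norm_neg _).trans_le (Padic.norm_int_le_one b), Padic.norm_int_le_one a⟩
  have hform (u : Fin 2 → ℚ_[p]) : wedge u z = a * u 0 + b * u 1 := by
    simp [wedge, z]; ring
  have hvz : ‖wedge v' z‖ ≤ r := by rw [hform]; exact_mod_cast hab
  calc ‖(a : ℚ_[p]) * y.rep 0 + b * y.rep 1‖ = ‖wedge y.rep z‖ * ‖v'‖ := by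
        rw [hform, hv', mul_one]
    _ ≤ max (‖wedge v' z‖ * ‖y.rep‖) (‖wedge v' y.rep‖ * ‖z‖) := norm_wedge_mul_norm_le _ _ _
    _ ≤ r * ‖y.rep‖ := max_le (by gcongr)
        ((mul_le_of_le_one_right (norm_nonneg _) hz).trans hy)

end IsPrimitiveRep

end IntegralCoordinates

noncomputable section AlgClosureAction

variable {p : ℕ} [Fact p.Prime]

variable (p) in
/-- The inclusion of `ℤ_p` in the algebraic closure of `ℚ_p`. -/
def intToAlgCl : ℤ_[p] →+* PadicAlgCl p :=
  (algebraMap ℚ_[p] (PadicAlgCl p)).comp PadicInt.Coe.ringHom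

theorem norm_intToAlgCl (z : ℤ_[p]) : ‖intToAlgCl p z‖ = ‖z‖ :=
  norm_algebraMap' (PadicAlgCl p) (z : ℚ_[p])

theorem IsPrimitiveRep.projDist_projToAlgCl {v : Fin 2 → ℤ_[p]} {x : ProjLine ℚ_[p]}
    (hv : IsPrimitiveRep v x) (w : ProjLine (PadicAlgCl p)) :
    projDist (projToAlgCl p x) w = ‖wedge (intToAlgCl p ∘ v) w.rep‖ / ‖w.rep‖ := by
  obtain ⟨hnorm, hv0, rfl⟩ := hv
  rw [projToAlgCl, Projectivization.map_mk, projDist_mk_left]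
  change ‖wedge (intToAlgCl p ∘ v) w.rep‖ / (‖intToAlgCl p ∘ v‖ * ‖w.rep‖) = _
  rw [norm_comp_eq norm_intToAlgCl, hnorm, one_mul]

variable (A : Matrix.GeneralLinearGroup (Fin 2) ℤ_[p])

theorem algClEnd_comp (v : Fin 2 → ℤ_[p]) :
    algClEnd A (intToAlgCl p ∘ v) = intToAlgCl p ∘ A.val.mulVec v :=
  funext fun i => ((intToAlgCl p).map_mulVec A.val v i).symm

theorem algClEnd_pow (n : ℕ) : algClEnd (A ^ n) = algClEnd A ^ n := by
  rw [algClEnd, algClEnd, ← Matrix.toLin'_pow, Units.val_pow_eq_pow_val]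
  exact congrArg _ (Matrix.map_pow A.val (intToAlgCl p) n)

theorem det_algClEnd : LinearMap.det (algClEnd A) = intToAlgCl p A.val.det := by
  rw [algClEnd, LinearMap.det_toLin']
  exact ((intToAlgCl p).map_det A.val).symm

theorem hasEigenvalue_glTranspose_iff {A : Matrix.GeneralLinearGroup (Fin 2) ℤ_[p]}
    {μ : PadicAlgCl p} :
    (algClEnd (glTranspose A)).HasEigenvalue μ ↔ (algClEnd A).HasEigenvalue μ := by
  simp only [Module.End.hasEigenvalue_iff_mem_spectrum, algClEnd, Matrix.spectrum_toLin',
    Matrix.mem_spectrum_iff_isRoot_charpoly]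
  rw [← Matrix.charpoly_transpose]
  rfl

theorem IsEigenpoint.pow {A : Matrix.GeneralLinearGroup (Fin 2) ℤ_[p]}
    {w : ProjLine (PadicAlgCl p)} (hw : IsEigenpoint A w) (n : ℕ) : IsEigenpoint (A ^ n) w := by
  obtain ⟨μ, hμ⟩ := hw
  refine ⟨μ ^ n, ?_⟩
  rw [algClEnd_pow, Module.End.hasEigenvector_iff, Module.End.mem_eigenspace_iff]
  exact ⟨hμ.pow_apply n, hμ.2⟩

end AlgClosureAction

section Pigeonhole

variable {p : ℕ} [Fact p.Prime]

theorem norm_le_inv_pow_iff_dvd {z : ℤ_[p]} {n : ℕ} :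
    ‖z‖ ≤ ((p : ℝ) ^ n)⁻¹ ↔ (p : ℤ_[p]) ^ n ∣ z := by
  rw [← Ideal.mem_span_singleton, ← PadicInt.norm_le_pow_iff_mem_span_pow, zpow_neg, zpow_natCast]

/- Modulo `p ^ s` the map `f` is injective, hence surjective, on a set of representatives. -/
theorem exists_lt_pow_norm_le_of_norm_sub_le {f : ℕ → ℤ_[p]}
    (hf : ∀ t t' : ℕ, ‖(t : ℤ_[p]) - t'‖ ≤ ‖f t - f t'‖) (s : ℕ) :
    ∃ t < p ^ s, ‖f t‖ ≤ ((p : ℝ) ^ s)⁻¹ := by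
  have hker {z : ℤ_[p]} : PadicInt.toZModPow s z = 0 ↔ ‖z‖ ≤ ((p : ℝ) ^ s)⁻¹ := by
    rw [← RingHom.mem_ker, PadicInt.ker_toZModPow, Ideal.mem_span_singleton,
      norm_le_inv_pow_iff_dvd]
  let g : Fin (p ^ s) → ZMod (p ^ s) := fun t => PadicInt.toZModPow s (f t)
  have hg : Function.Injective g := fun t t' h => by
    have hsub : PadicInt.toZModPow s ((t : ℕ) - (t' : ℕ) : ℤ_[p]) = 0 :=
      hker.mpr <| (hf t t').trans <| hker.mp <| by rw [map_sub, sub_eq_zero]; exact h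
    rw [map_sub, map_natCast, map_natCast, sub_eq_zero, ZMod.natCast_eq_natCast_iff] at hsub
    exact Fin.ext (hsub.eq_of_lt_of_lt t.2 t'.2)
  have : NeZero (p ^ s) := ⟨(pow_pos (Fact.out : p.Prime).pos s).ne'⟩
  have hbij := (Fintype.bijective_iff_injective_and_card g).mpr
    ⟨hg, by rw [Fintype.card_fin, ZMod.card]⟩
  obtain ⟨t, ht⟩ := hbij.surjective 0
  exact ⟨t, t.2, hker.mp ht⟩

theorem exists_norm_sub_natCast_le {z : ℕ → ℤ_[p]} {l : ℕ}
    (hz : ∀ t t' : ℕ, ‖z t - z t'‖ = ((p : ℝ) ^ l)⁻¹ * ‖(t : ℤ_[p]) - t'‖) (s : ℕ) :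
    ∃ c < p ^ l, ∃ t < p ^ s, ‖z t - c‖ ≤ ((p : ℝ) ^ (l + s))⁻¹ := by
  have hpl : ‖(p : ℤ_[p]) ^ l‖ = ((p : ℝ) ^ l)⁻¹ := by
    rw [PadicInt.norm_p_pow, zpow_neg, zpow_natCast]
  have hpl0 : 0 < ((p : ℝ) ^ l)⁻¹ := by have := (Fact.out : p.Prime).pos; positivity
  have hdvd (t : ℕ) : (p : ℤ_[p]) ^ l ∣ z t - (z 0).appr l := by
    rw [← sub_add_sub_cancel (z t) (z 0)]
    refine dvd_add (norm_le_inv_pow_iff_dvd.mp ?_)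
      (Ideal.mem_span_singleton.mp (PadicInt.appr_spec l (z 0)))
    rw [hz]
    exact mul_le_of_le_one_right hpl0.le (PadicInt.norm_le_one _)
  choose f hf using hdvd
  obtain ⟨t, ht, hft⟩ := exists_lt_pow_norm_le_of_norm_sub_le (f := f) (s := s) fun t t' => by
    refine le_of_mul_le_mul_left ?_ hpl0
    rw [← hz, ← hpl, ← norm_mul, mul_sub, ← hf, ← hf, sub_sub_sub_cancel_right]
  refine ⟨(z 0).appr l, PadicInt.appr_lt _ _, t, ht, ?_⟩
  rw [hf, norm_mul, hpl, pow_add, mul_inv]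
  exact mul_le_mul_of_nonneg_left hft hpl0.le

theorem norm_zero_eq_one_of_norm_wedge_lt_one {v w : Fin 2 → ℤ_[p]} (hv : ‖v 0‖ = 1)
    (hw : ‖w‖ = 1) (hvw : ‖wedge v w‖ < 1) : ‖w 0‖ = 1 := by
  by_contra hne
  have hw0 : ‖w 0‖ < 1 := lt_of_le_of_ne (PadicInt.norm_le_one _) hne
  have hw1 : ‖v 0 * w 1‖ < 1 := by
    rw [← sub_add_cancel (v 0 * w 1) (v 1 * w 0)]
    exact PadicInt.norm_lt_one_add hvw (PadicInt.norm_lt_one_mul hw0)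
  rw [norm_mul, hv, one_mul] at hw1
  exact ((pi_norm_lt_iff one_pos).mpr (Fin.forall_fin_two.mpr ⟨hw0, hw1⟩)).ne hw

theorem exists_norm_mul_sub_le {V : ℕ → Fin 2 → ℤ_[p]} (hV : ∀ t, ‖V t 0‖ = 1) {l : ℕ}
    (hw : ∀ t t' : ℕ, ‖wedge (V t) (V t')‖ = ((p : ℝ) ^ l)⁻¹ * ‖(t : ℤ_[p]) - t'‖) (s : ℕ) :
    ∃ c < p ^ l, ∃ t < p ^ s, ‖(c : ℤ_[p]) * V t 0 - V t 1‖ ≤ ((p : ℝ) ^ (l + s))⁻¹ := by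
  choose z hz using fun t => (PadicInt.isUnit_iff.mpr (hV t)).dvd (a := V t 1)
  obtain ⟨c, hc, t, ht, h⟩ := exists_norm_sub_natCast_le (z := z) (l := l) (s := s) fun t t' => by
    have hwedge : wedge (V t) (V t') = V t 0 * V t' 0 * (z t' - z t) := by
      rw [wedge, hz, hz]; ring
    rw [← hw, hwedge, norm_mul, norm_mul, hV, hV, one_mul, one_mul, norm_sub_rev]
  refine ⟨c, hc, t, ht, ?_⟩
  rwa [hz, mul_comm, ← mul_sub, norm_mul, hV, one_mul, norm_sub_rev]

theorem exists_norm_int_form_le {V : ℕ → Fin 2 → ℤ_[p]} (hV : ∀ t, ‖V t‖ = 1) {l : ℕ} (hl : l ≠ 0)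
    (hw : ∀ t t' : ℕ, ‖wedge (V t) (V t')‖ = ((p : ℝ) ^ l)⁻¹ * ‖(t : ℤ_[p]) - t'‖) (s : ℕ) :
    ∃ a b : ℤ, (a, b) ≠ (0, 0) ∧ max ((a : ℝ) ^ 2) ((b : ℝ) ^ 2) < ((p : ℝ) ^ l) ^ 2 ∧
      ∃ t < p ^ s, ‖(a : ℤ_[p]) * V t 0 + b * V t 1‖ ≤ ((p : ℝ) ^ (l + s))⁻¹ := by
  have hpl : 1 < (p : ℝ) ^ l := one_lt_pow₀ (mod_cast (Fact.out : p.Prime).one_lt) hl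
  have hlt (t t' : ℕ) : ‖wedge (V t) (V t')‖ < 1 := by
    rw [hw]
    exact (mul_le_of_le_one_right (by positivity) (PadicInt.norm_le_one _)).trans_lt
      (inv_lt_one_of_one_lt₀ hpl)
  have hsq {c : ℕ} (hc : c < p ^ l) : max ((c : ℝ) ^ 2) 1 < ((p : ℝ) ^ l) ^ 2 :=
    max_lt (by gcongr; exact_mod_cast hc) (one_lt_pow₀ hpl two_ne_zero)
  obtain h0 | h1 : ‖V 0 0‖ = 1 ∨ ‖V 0 1‖ = 1 := by
    by_contra! h
    exact ((pi_norm_lt_iff one_pos).mpr (Fin.forall_fin_two.mpr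
      ⟨(PadicInt.norm_le_one _).lt_of_ne h.1, (PadicInt.norm_le_one _).lt_of_ne h.2⟩)).ne (hV 0)
  · obtain ⟨c, hc, t, ht, h⟩ := exists_norm_mul_sub_le
      (fun t => norm_zero_eq_one_of_norm_wedge_lt_one h0 (hV t) (hlt 0 t)) hw s
    exact ⟨c, -1, by simp, by simpa using hsq hc, t, ht, by simpa [sub_eq_add_neg] using h⟩
  · let W : ℕ → Fin 2 → ℤ_[p] := fun t => V t ∘ Equiv.swap 0 1
    have hle (v : Fin 2 → ℤ_[p]) : ‖v ∘ Equiv.swap 0 1‖ ≤ ‖v‖ :=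
      (pi_norm_le_iff_of_nonneg (norm_nonneg v)).mpr fun i => norm_le_pi_norm v _
    have hW (t : ℕ) : ‖W t‖ = 1 := by
      refine ((hle (V t)).antisymm ((hle (W t)).trans' (le_of_eq ?_))).trans (hV t)
      simp [W, Function.comp_def]
    have hwedge (t t' : ℕ) : ‖wedge (W t) (W t')‖ = ‖wedge (V t) (V t')‖ := by
      simp only [W, wedge, Function.comp_apply, Equiv.swap_apply_left, Equiv.swap_apply_right]
      rw [norm_sub_rev]
    obtain ⟨c, hc, t, ht, h⟩ := exists_norm_mul_sub_le
      (fun t => norm_zero_eq_one_of_norm_wedge_lt_one (v := W 0) h1 (hW t)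
        ((hwedge 0 t).trans_lt (hlt 0 t))) (fun t t' => (hwedge t t').trans (hw t t')) s
    refine ⟨-1, c, by simp, by simpa [max_comm] using hsq hc, t, ht, ?_⟩
    simpa [W, sub_eq_add_neg, add_comm] using h

theorem exists_norm_int_form_le_of_le {V : ℕ → Fin 2 → ℤ_[p]} (hV : ∀ t, ‖V t‖ = 1) {l₀ l K : ℕ}
    (hw : ∀ t t' : ℕ, ‖wedge (V t) (V t')‖ = ((p : ℝ) ^ l₀)⁻¹ * ‖(t : ℤ_[p]) - t'‖)
    (hl₀ : l₀ ≤ l) (hl : l ≠ 0) (hlK : l ≤ K) :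
    ∃ a b : ℤ, (a, b) ≠ (0, 0) ∧ max ((a : ℝ) ^ 2) ((b : ℝ) ^ 2) < ((p : ℝ) ^ l) ^ 2 ∧
      ∃ t < p ^ (K - l₀), ‖(a : ℤ_[p]) * V t 0 + b * V t 1‖ ≤ ((p : ℝ) ^ K)⁻¹ := by
  obtain ⟨a, b, hab, hlt, t, ht, h⟩ := exists_norm_int_form_le
    (V := fun t => V (p ^ (l - l₀) * t)) (fun t => hV _) hl (fun t t' => by
      rw [hw, Nat.cast_mul, Nat.cast_mul, ← mul_sub, norm_mul, Nat.cast_pow, PadicInt.norm_p_pow,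
        zpow_neg, zpow_natCast, ← mul_assoc, ← mul_inv, ← pow_add, Nat.add_sub_cancel' hl₀]) (K - l)
  refine ⟨a, b, hab, hlt, p ^ (l - l₀) * t, ?_, by rwa [Nat.add_sub_cancel' hlK] at h⟩
  rw [← tsub_add_tsub_cancel hlK hl₀, add_comm, pow_add]
  exact Nat.mul_lt_mul_of_pos_left ht (pow_pos (Fact.out : p.Prime).pos _)

theorem exists_norm_int_form_le_inv {V : ℕ → Fin 2 → ℤ_[p]} (hV : ∀ t, ‖V t‖ = 1) {ρ a D : ℝ}
    (hρ : ∀ t t' : ℕ, ‖wedge (V t) (V t')‖ = ρ * ‖(t : ℤ_[p]) - t'‖)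
    (ha : 0 < a) (haρ : a ≤ ρ) (hap : a ≤ (p : ℝ)⁻¹) (haD : a⁻¹ ≤ D) :
    ∃ c d : ℤ, (c, d) ≠ (0, 0) ∧ max ((c : ℝ) ^ 2) ((d : ℝ) ^ 2) < a⁻¹ ^ 2 ∧
      ∃ t : ℕ, (t : ℝ) ≤ p * ρ * D ∧ ‖(c : ℤ_[p]) * V t 0 + d * V t 1‖ ≤ D⁻¹ := by
  have hp1 : 1 < (p : ℝ) := mod_cast (Fact.out : p.Prime).one_lt
  have hρ0 : 0 < ρ := ha.trans_le haρ
  obtain ⟨l₀, hl₀⟩ : ∃ l₀ : ℕ, ρ = ((p : ℝ) ^ l₀)⁻¹ := by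
    have hρ01 : ‖wedge (V 0) (V 1)‖ = ρ := by simpa using hρ 0 1
    have hwedge : wedge (V 0) (V 1) ≠ 0 := norm_ne_zero_iff.mp (hρ01 ▸ hρ0.ne')
    exact ⟨_, by rw [← hρ01, PadicInt.norm_eq_zpow_neg_valuation hwedge, zpow_neg, zpow_natCast]⟩
  have hla : (p : ℝ) ^ max l₀ 1 ≤ a⁻¹ := by
    rcases max_choice l₀ 1 with h | h <;> rw [h, le_inv_comm₀ (by positivity) ha]
    · exact hl₀ ▸ haρ
    · rwa [pow_one]
  have hD1 : 1 ≤ D := (one_le_pow₀ hp1.le).trans (hla.trans haD)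
  obtain ⟨n, hnD, hDn⟩ := exists_nat_pow_near hD1 hp1
  have hln : max l₀ 1 ≤ n + 1 := (pow_le_pow_iff_right₀ hp1).mp (hla.trans (haD.trans hDn.le))
  obtain ⟨c, d, hcd, hlt, t, ht, hform⟩ := exists_norm_int_form_le_of_le hV (hl₀ ▸ hρ)
    (le_max_left l₀ 1) (by simp) hln
  refine ⟨c, d, hcd, hlt.trans_le (by gcongr), t, ?_, hform.trans (by gcongr)⟩
  calc (t : ℝ) ≤ (p : ℝ) ^ (n + 1 - l₀) := mod_cast ht.le
    _ = p * ρ * (p : ℝ) ^ n := by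
      rw [hl₀, pow_sub₀ _ (by positivity) (le_of_max_le_left hln), pow_succ]; ring
    _ ≤ p * ρ * D := by gcongr

end Pigeonhole

section OrbitWedge

variable {p : ℕ} [Fact p.Prime]

theorem norm_wedge_pow_mulVec {B : Matrix.GeneralLinearGroup (Fin 2) ℤ_[p]} (hB : B.val.det = 1)
    {w₁ w₂ : ProjLine (PadicAlgCl p)} (hw : w₁ ≠ w₂) (h₁ : IsEigenpoint B w₁)
    (h₂ : IsEigenpoint B w₂) {μ : PadicAlgCl p} (hμ : (algClEnd B).HasEigenvalue μ)
    (hμ2 : ‖μ ^ 2 - 1‖ < 1 / 2) {v : Fin 2 → ℤ_[p]} {x : ProjLine ℚ_[p]} (hv : IsPrimitiveRep v x)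
    (t s : ℕ) :
    ‖wedge ((B ^ t).val.mulVec v) ((B ^ s).val.mulVec v)‖ =
      projDist (projToAlgCl p x) w₁ * projDist (projToAlgCl p x) w₂ / projDist w₁ w₂ *
        ‖μ ^ 2 - 1‖ * ‖(t : ℤ_[p]) - s‖ := by
  obtain ⟨μ₁, h₁⟩ := h₁
  obtain ⟨μ₂, h₂⟩ := h₂
  have hw0 := wedge_rep_ne_zero hw
  have hdet : LinearMap.det (algClEnd B) = 1 := by rw [det_algClEnd, hB, map_one]
  have hmul : μ₁ * μ₂ = 1 := (det_eq_mul_of_hasEigenvector h₁ h₂ hw0).symm.trans hdet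
  have hpow : ‖μ₁ ^ s * μ₂ ^ t - μ₁ ^ t * μ₂ ^ s‖ = ‖(t : ℤ_[p]) - s‖ * ‖μ ^ 2 - 1‖ := by
    have hcast : ‖(t : ℤ_[p]) - s‖ = ‖(t : ℚ_[p]) - s‖ := by
      rw [PadicInt.norm_def, PadicInt.coe_sub, PadicInt.coe_natCast, PadicInt.coe_natCast]
    rw [hcast]
    rcases eq_or_eq_of_hasEigenvalue h₁ h₂ hw0 (hdet ▸ one_ne_zero) hμ with rfl | rfl
    · rw [norm_pow_mul_pow_sub p hmul hμ2, norm_sub_rev]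
    · rw [mul_comm (μ₁ ^ s), mul_comm (μ₁ ^ t),
        norm_pow_mul_pow_sub p ((mul_comm _ _).trans hmul) hμ2]
  have horbit (n : ℕ) : intToAlgCl p ∘ (B ^ n).val.mulVec v =
      (algClEnd B ^ n) (intToAlgCl p ∘ v) := by
    rw [← algClEnd_pow, algClEnd_comp]
  have hwedge := congrArg norm (wedge_mul_wedge_pow_apply h₁ h₂ hw0 (intToAlgCl p ∘ v) t s)
  rw [← horbit, ← horbit, ← map_wedge, norm_mul, norm_mul, norm_mul, norm_intToAlgCl, hpow]
    at hwedge
  have h₁0 := norm_ne_zero_iff.mpr w₁.rep_nonzero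
  have h₂0 := norm_ne_zero_iff.mpr w₂.rep_nonzero
  have hw0' := norm_ne_zero_iff.mpr hw0
  rw [hv.projDist_projToAlgCl, hv.projDist_projToAlgCl, projDist_eq_norm_wedge_div,
    ← mul_right_inj' hw0', hwedge]
  field_simp

end OrbitWedge

section PBad

variable {p : ℕ} [Fact p.Prime] {ε : ℝ}

theorem le_one_of_mem_pBad {y : ProjLine ℚ_[p]} (hy : y ∈ PBad p ε) : ε ≤ 1 := by
  have h := hy 1 0 (by simp)
  have hle : ‖y.rep 0‖ / vecHeight y.rep ≤ 1 := div_le_one_of_le₀ (le_max_left _ _)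
    (le_max_of_le_left (norm_nonneg _))
  simpa using h.trans (by simpa using hle)

theorem lt_mul_of_mem_pBad {y : ProjLine ℚ_[p]} (hy : y ∈ PBad p ε) {a b : ℤ}
    (hab : (a, b) ≠ (0, 0)) {r H : ℝ} (hr : 0 < r) (hH : max ((a : ℝ) ^ 2) ((b : ℝ) ^ 2) < H)
    (h : ‖(a : ℚ_[p]) * y.rep 0 + b * y.rep 1‖ / vecHeight y.rep ≤ r) : ε < r * H := by
  have hpos : 0 < max ((a : ℝ) ^ 2) ((b : ℝ) ^ 2) := by
    contrapose! hab
    have := max_le_iff.mp hab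
    simpa [sq_nonpos_iff] using this
  exact ((div_le_iff₀ hpos).mp ((hy a b hab).trans h)).trans_lt (mul_lt_mul_of_pos_left hH hr)

theorem not_subset_pBad {V : ℕ → Fin 2 → ℤ_[p]} {X : ℕ → ProjLine ℚ_[p]}
    (hVX : ∀ t, IsPrimitiveRep (V t) (X t)) {ρ a : ℝ}
    (hρ : ∀ t t' : ℕ, ‖wedge (V t) (V t')‖ = ρ * ‖(t : ℤ_[p]) - t'‖)
    (ha : 0 < a) (haρ : a ≤ ρ) (hap : a ≤ (p : ℝ)⁻¹) (hε : 0 < ε) {S : Set (ProjLine ℚ_[p])}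
    (hS : ∀ t : ℕ, (t : ℝ) ≤ p * ρ * (ε * a ^ 2)⁻¹ → ∃ y ∈ S, projDist (X t) y ≤ ε * a ^ 2) :
    ¬ S ⊆ PBad p ε := by
  intro hSε
  have hp1 : 1 ≤ (p : ℝ) := mod_cast (Fact.out : p.Prime).one_le
  have hρ0 : 0 < ρ := ha.trans_le haρ
  obtain ⟨y₀, hy₀, -⟩ := hS 0 (by simpa using by positivity)
  have haD : a⁻¹ ≤ (ε * a ^ 2)⁻¹ := by
    refine inv_anti₀ (by positivity) ?_
    nlinarith [mul_le_of_le_one_left (sq_nonneg a) (le_one_of_mem_pBad (hSε hy₀)),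
      hap.trans (inv_le_one_of_one_le₀ hp1)]
  obtain ⟨c, d, hcd, hlt, t, ht, hform⟩ :=
    exists_norm_int_form_le_inv (fun t => (hVX t).1) hρ ha haρ hap haD
  rw [inv_inv] at hform
  obtain ⟨y, hy, hdist⟩ := hS t ht
  refine lt_irrefl ε ?_
  calc ε < ε * a ^ 2 * a⁻¹ ^ 2 := lt_mul_of_mem_pBad (hSε hy) hcd (by positivity) hlt
        ((hVX t).norm_form_div_le hdist hform)
    _ = ε := by field_simp

end PBad

section Orbit

variable {p : ℕ} [Fact p.Prime]

theorem det_glTranspose_pow_eq_one {A : Matrix.GeneralLinearGroup (Fin 2) ℤ_[p]} (hA : A ∈ SLpm p)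
    {n : ℕ} (hn : Even n) : (glTranspose A ^ n).val.det = 1 := by
  rw [Units.val_pow_eq_pow_val, Matrix.det_pow, glTranspose, Matrix.det_transpose]
  rcases hA with h | h <;> rw [h]
  · exact one_pow n
  · exact hn.neg_one_pow

theorem not_subset_pBad_of_isEigenpoint {A : Matrix.GeneralLinearGroup (Fin 2) ℤ_[p]}
    (hA : A ∈ SLpm p) {w₁ w₂ : ProjLine (PadicAlgCl p)} (hw : w₁ ≠ w₂)
    (hw₁ : IsEigenpoint (glTranspose A) w₁) (hw₂ : IsEigenpoint (glTranspose A) w₂)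
    {lam : PadicAlgCl p} (hlam : (algClEnd A).HasEigenvalue lam) {n : ℕ} (hn : Even n)
    (hlam1 : lam ^ (n * 2) ≠ 1) (hlam2 : ‖lam ^ (n * 2) - 1‖ < 1 / 2) {x : ProjLine ℚ_[p]}
    {δ : ℝ} (hδ : 0 < δ) (hδp : δ ≤ (p : ℝ)⁻¹)
    (hδw : δ ≤ min (projDist (projToAlgCl p x) w₁) (projDist (projToAlgCl p x) w₂))
    {ε : ℝ} (hε : 0 < ε) {S : Set (ProjLine ℚ_[p])}
    (hS : ∀ t : ℕ, (t : ℝ) ≤ p * (projDist (projToAlgCl p x) w₁ * projDist (projToAlgCl p x) w₂ /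
        projDist w₁ w₂ * ‖lam ^ (n * 2) - 1‖) * (ε * (‖lam ^ (n * 2) - 1‖ * δ) ^ 2)⁻¹ →
      ∃ y ∈ S, projDist (toPadicGL (glTranspose A) ^ (n * t) • x) y ≤
        ε * (‖lam ^ (n * 2) - 1‖ * δ) ^ 2) :
    ¬ S ⊆ PBad p ε := by
  obtain ⟨v, hv⟩ := exists_isPrimitiveRep x
  have hd : 0 < projDist w₁ w₂ := projDist_pos hw
  have hlam0 : 0 < ‖lam ^ (n * 2) - 1‖ := norm_pos_iff.mpr (sub_ne_zero.mpr hlam1)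
  have hμ : (algClEnd (glTranspose A ^ n)).HasEigenvalue (lam ^ n) := by
    rw [algClEnd_pow]
    exact (hasEigenvalue_glTranspose_iff.mpr hlam).pow n
  have hrep (t : ℕ) : IsPrimitiveRep (((glTranspose A ^ n) ^ t).val.mulVec v)
      (toPadicGL (glTranspose A) ^ (n * t) • x) := by
    have hmap : toPadicGL (glTranspose A) ^ (n * t) = toPadicGL ((glTranspose A ^ n) ^ t) := by
      rw [← pow_mul]; exact (map_pow _ _ _).symm
    exact hmap ▸ hv.smul _
  have hwedge := norm_wedge_pow_mulVec (det_glTranspose_pow_eq_one hA hn) hw (hw₁.pow n)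
    (hw₂.pow n) hμ (by rwa [← pow_mul]) hv
  rw [← pow_mul] at hwedge
  refine not_subset_pBad hrep hwedge (mul_pos hlam0 hδ) ?_ ?_ hε hS
  · rw [mul_comm]
    refine mul_le_mul_of_nonneg_right ((le_div_iff₀ hd).mpr ?_) hlam0.le
    exact (mul_le_mul_of_nonneg_right hδw hd.le).trans (min_projDist_mul_projDist_le _ _ _)
  · exact (mul_le_of_le_one_left hδ.le (hlam2.le.trans (by norm_num))).trans hδp

theorem sqrt_div_mul_sq {X Y a : ℝ} (hX : 0 ≤ X) (ha : 0 ≤ a) :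
    √(X / (a ^ 2 * Y)) * a ^ 2 = (√Y / (a * √X))⁻¹ := by
  rw [Real.sqrt_div hX, Real.sqrt_mul (sq_nonneg a), Real.sqrt_sq ha, inv_div]
  rcases ha.eq_or_lt with rfl | ha
  · simp
  · field_simp

/- `ε` is chosen such that the `t` iterates of `(Aᵀ) ^ (2 * κ)` which the pigeonhole principle needs
are among the first `m` iterates of `Aᵀ`. -/
theorem two_mul_mul_le_of_sq_eq_div {ε ε₁ ε₂ ε₃ a d m q κ t : ℝ} (hε0 : 0 < ε) (hε1 : ε ≤ 1)
    (hε₃ : ε₃ ≤ 1) (ha : 0 < a) (hd : 0 < d) (hm : 0 < m) (hκ : 0 ≤ κ)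
    (hεsq : ε ^ 2 = 2 * ε₁ * ε₂ * q * κ / (a ^ 2 * (d * m)))
    (ht : t ≤ q * (ε₁ * ε₂ / d * ε₃) * (ε * a ^ 2)⁻¹) : 2 * κ * t ≤ m := by
  rw [eq_div_iff (by positivity)] at hεsq
  calc 2 * κ * t ≤ 2 * κ * (q * (ε₁ * ε₂ / d * ε₃) * (ε * a ^ 2)⁻¹) := by gcongr
    _ = 2 * ε₁ * ε₂ * q * κ * ε₃ / (d * (ε * a ^ 2)) := by field_simp
    _ = ε * ε₃ * m := by rw [← hεsq]; field_simp
    _ ≤ ε * 1 * m := by gcongr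
    _ ≤ m := by rw [mul_one]; exact mul_le_of_le_one_left hm.le hε1

theorem theorem3p3_general {A : Matrix.GeneralLinearGroup (Fin 2) ℤ_[p]} (hA : A ∈ SLpm p) {κ : ℕ}
    {w₁ w₂ : ProjLine (PadicAlgCl p)} (hw : w₁ ≠ w₂) (hw₁ : IsEigenpoint (glTranspose A) w₁)
    (hw₂ : IsEigenpoint (glTranspose A) w₂) {lam : PadicAlgCl p}
    (hlam : (algClEnd A).HasEigenvalue lam) (hnear : ‖lam ^ (4 * κ) - 1‖ < 1 / 2)
    (hlog : padicLog p (lam ^ (4 * κ)) ≠ 0) {x : ProjLine ℚ_[p]} {ε₁ ε₂ ε₃ δ : ℝ}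
    (hε₁ : ε₁ = projDist (projToAlgCl p x) w₁) (hε₂ : ε₂ = projDist (projToAlgCl p x) w₂)
    (hε₃ : ε₃ = ‖padicLog p (lam ^ (4 * κ))‖)
    (hδ : δ = min (min ε₁ ε₂) (p : ℝ)⁻¹) (hδ0 : δ ≠ 0) {m k : ℕ} (hm : 0 < m)
    (hpk : √(projDist w₁ w₂ * m) / (ε₃ * δ * √(2 * ε₁ * ε₂ * p * κ)) ≤ (p : ℝ) ^ k)
    {S : Set (ProjLine ℚ_[p])}
    (hS : ∀ t, 2 * κ * t ≤ m → ∃ y ∈ S,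
      projDist (toPadicGL (glTranspose A) ^ (2 * κ * t) • x) y ≤ ((p : ℝ) ^ k)⁻¹) :
    ¬ S ⊆ PBad p √((2 * ε₁ * ε₂ * p * κ) / (ε₃ ^ 2 * δ ^ 2 * projDist w₁ w₂ * m)) := by
  have hexp : 4 * κ = 2 * κ * 2 := by ring
  have hε₃' : ε₃ = ‖lam ^ (2 * κ * 2) - 1‖ := by rw [hε₃, norm_padicLog hnear, hexp]
  have hε₃0 : 0 < ε₃ := hε₃ ▸ norm_pos_iff.mpr hlog
  have hlam1 : lam ^ (2 * κ * 2) ≠ 1 := sub_ne_zero.mp (norm_pos_iff.mp (hε₃' ▸ hε₃0))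
  have hκ0 : κ ≠ 0 := fun h => hlam1 (by simp [h])
  have hp0 : 0 < (p : ℝ) := mod_cast (Fact.out : p.Prime).pos
  have hd := projDist_pos hw
  have hδpos : 0 < δ := by
    refine hδ0.symm.lt_of_le ?_
    rw [hδ, hε₁, hε₂]
    exact le_min (le_min (projDist_nonneg _ _) (projDist_nonneg _ _)) (by positivity)
  obtain ⟨hδmin, hδp⟩ := le_min_iff.mp hδ.le
  have hε₁0 : 0 < ε₁ := hδpos.trans_le (le_of_le_min_left hδmin)
  have hε₂0 : 0 < ε₂ := hδpos.trans_le (le_of_le_min_right hδmin)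
  rw [← mul_pow, mul_assoc (_ ^ 2)]
  set ε := √(2 * ε₁ * ε₂ * p * κ / ((ε₃ * δ) ^ 2 * (projDist w₁ w₂ * m))) with hε
  have hε0 : 0 < ε := by positivity
  have hk : ((p : ℝ) ^ k)⁻¹ ≤ ε * (ε₃ * δ) ^ 2 := by
    rw [hε, sqrt_div_mul_sq (by positivity) (by positivity)]
    exact inv_anti₀ (by positivity) hpk
  intro hSε
  obtain ⟨y₀, hy₀, -⟩ := hS 0 (by simp)
  rw [hexp] at hnear
  refine not_subset_pBad_of_isEigenpoint hA hw hw₁ hw₂ hlam (even_two_mul κ) hlam1 hnear hδpos hδp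
    (hε₁ ▸ hε₂ ▸ hδmin) hε0 (fun t ht => ?_) hSε
  rw [← hε₃', ← hε₁, ← hε₂] at ht
  have htm : 2 * (κ : ℝ) * t ≤ m := two_mul_mul_le_of_sq_eq_div hε0 (le_one_of_mem_pBad (hSε hy₀))
    (hε₃' ▸ hnear.le.trans (by norm_num)) (by positivity) hd (by positivity) (by positivity)
    (Real.sq_sqrt (by positivity)) ht
  obtain ⟨y, hy, hdist⟩ := hS t (mod_cast htm)
  exact ⟨y, hy, hε₃' ▸ hdist.trans hk⟩

theorem IsKappa.norm_pow_sub_one_lt {A : Matrix.GeneralLinearGroup (Fin 2) ℤ_[p]} {κ : ℕ}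
    (hκ : IsKappa A κ) {lam : PadicAlgCl p} (hlam : (algClEnd A).HasEigenvalue lam) :
    ‖lam ^ (4 * κ) - 1‖ < 1 / 2 := by
  rw [mul_comm, pow_mul]
  exact norm_pow_four_sub_one_lt p (hκ.2.2 lam hlam)

theorem MemSLTilde.padicLog_pow_ne_zero {A : Matrix.GeneralLinearGroup (Fin 2) ℤ_[p]} {κ : ℕ}
    (hA : MemSLTilde A κ) (hκ : IsKappa A κ) {lam : PadicAlgCl p}
    (hlam : (algClEnd A).HasEigenvalue lam) : padicLog p (lam ^ (4 * κ)) ≠ 0 := by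
  have hnear : ‖lam ^ κ - 1‖ < 1 := (hκ.2.2 lam hlam).trans_lt <|
    inv_lt_one_of_one_lt₀ <| mod_cast (Fact.out : p.Prime).one_lt
  rw [mul_comm, pow_mul]
  exact _root_.padicLog_pow_ne_zero hnear four_ne_zero (hA.2 lam hlam)

end Orbit

theorem theorem3p3 (p : ℕ) [Fact p.Prime]
    (A : Matrix.GeneralLinearGroup (Fin 2) ℤ_[p])
    (κ : ℕ) (hκ : IsKappa A κ) (hA : MemSLTilde A κ)
    (w₁ w₂ : ProjLine (PadicAlgCl p)) (hw : w₁ ≠ w₂)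
    (hw₁ : IsEigenpoint (glTranspose A) w₁) (hw₂ : IsEigenpoint (glTranspose A) w₂)
    (lam : PadicAlgCl p) (hlam : (algClEnd A).HasEigenvalue lam)
    (N : ℕ) (w : ℕ → ℕ) (hwN : w ∈ boundedWords N) (xp : ProjLine ℚ_[p])
    (ε₁ ε₂ ε₃ δ : ℝ)
    (hε₁ : ε₁ = projDist (projToAlgCl p xp) w₁)
    (hε₂ : ε₂ = projDist (projToAlgCl p xp) w₂)
    (hε₃ : ε₃ = ‖padicLog p (lam ^ (4 * κ))‖)
    (hδ : δ = min (min ε₁ ε₂) (p : ℝ)⁻¹) (hδ0 : δ ≠ 0)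
    (m k : ℕ) (hm : 0 < m)
    (hpk : √(projDist w₁ w₂ * m) / (ε₃ * δ * √(2 * ε₁ * ε₂ * p * κ)) ≤ (p : ℝ) ^ k)
    (horbit : ∀ j ≤ m, toPadicGL (glTranspose A) ^ j • xp ∈ orbitNhd p k (w, xp)) :
    (w, xp) ∉ LMad p
      √((2 * ε₁ * ε₂ * p * κ) / (ε₃ ^ 2 * δ ^ 2 * projDist w₁ w₂ * m)) :=
  fun hLMad => theorem3p3_general (S := Set.range fun n => ((extShift p)^[n] (w, xp)).2)
    hA.1.1 hw hw₁ hw₂ hlam (hκ.norm_pow_sub_one_lt hlam) (hA.padicLog_pow_ne_zero hκ hlam)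
    hε₁ hε₂ hε₃ hδ hδ0 hm hpk (fun _ ht => Set.exists_range_iff.mpr (horbit _ ht))
    (Set.range_subset_iff.mpr fun n => (hLMad n).2)
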